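/- All rings are associative with identity (not necessarily commutative). For a ring $R$, $J(R)$ denotes its Jacobson radical, and $J(R)$ is called nil if each of its elements is nilpotent. A ring $R$ is called Yaqub nil-clean if for every $a\in R$ at least one of $a+a^3$, $a-a^3$ is nilpotent. A ring is called Boolean if $x^2=x$ for all of its elements $x$, and is called a Yaqub ring if it is a subdirect product of copies of $\mathbb{Z}_3=\mathbb{Z}/3\mathbb{Z}$, that is, if it admits an injective ring homomorphism into a product $\prod_{i\in I}\mathbb{Z}_3$ whose composition with each coordinate projection is surjective. **Theorem.** A ring $R$ is Yaqub nil-clean if and only if both of the following hold: 1. $J(R)$ is nil; 2. $R/J(R)$ is isomorphic, as a ring, to one of the following: a Boolean ring $R_1$, a Yaqub ring $R_2$, $\mathbb{Z}_5=\mathbb{Z}/5\mathbb{Z}$, a product $R_1\times R_2$ of a Boolean ring $R_1$ and a Yaqub ring $R_2$, or a product $R_1\times\mathbb{Z}_5$ with $R_1$ a Boolean ring. -/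

import Mathlib

universe u

/-- A ring `R` is Yaqub nil-clean if for every `a`, one of `a + a ^ 3`, `a - a ^ 3` is nilpotent. -/
def IsYaqubNilClean (R : Type u) [Ring R] : Prop :=
  ∀ a : R, IsNilpotent (a + a ^ 3) ∨ IsNilpotent (a - a ^ 3)

/-- A Yaqub ring is a subdirect product of copies of `ℤ/3`: it embeds into a product of copies
of `ℤ/3` so that each coordinate projection restricted to it is surjective. Universe `u` is no
restriction on the index type, as distinct coordinates may be taken to be distinct ring
homomorphisms `S →+* ZMod 3`. -/
def IsYaqubRing (S : Type u) [Ring S] : Prop :=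
  ∃ (ι : Type u) (f : S →+* (ι → ZMod 3)),
    Function.Injective f ∧ ∀ i : ι, Function.Surjective (fun x : S => f x i)

/-! For `x` in the radical, `1 ± x²` is left invertible, so nilpotence of `x(1 ± x²)` gives that of
`x`. In the quotient `S`, which has zero radical, every non-nilpotent element has a nonzero
idempotent left multiple. A nonzero `x` with `x² = 0` would then produce `2 × 2` matrix units, which
two test matrices exclude; so `S` is reduced and every `a` satisfies `a³ = ±a`. Taking `a = 2` gives
`6 = 0` or `10 = 0`. The 2-component is Boolean, the 3-component satisfies `y³ = y`, and the
5-component has at most five elements. Hence `S` is commutative and the Chinese remainder theorem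
splits it. Conversely, the identities `a³ = ±a` hold in each listed quotient and lift modulo the nil
radical. -/

theorem IsNilpotent.exists_pow_zsmul_eq_zero {S : Type*} [Ring S] {c e : S} {k : ℤ}
    (hc : IsNilpotent c) (h : c * e = k • e) : ∃ n : ℕ, k ^ n • e = 0 := by
  obtain ⟨n, hn⟩ := hc
  have key : ∀ m : ℕ, c ^ m * e = k ^ m • e := by
    intro m
    induction m with
    | zero => simp
    | succ m ih => rw [_root_.pow_succ, mul_assoc, h, mul_smul_comm, ih, smul_smul, _root_.pow_succ']
  exact ⟨n, by rw [← key, hn, zero_mul]⟩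

/-! ### The radical is nil -/

theorem isNilpotent_of_isNilpotent_mul_of_leftInverse {R : Type*} [Ring R] {x w s : R}
    (hcomm : Commute x w) (hs : s * w = 1) (h : IsNilpotent (x * w)) : IsNilpotent x := by
  obtain ⟨n, hn⟩ := h
  refine ⟨n, ?_⟩
  rw [hcomm.eq, hcomm.symm.mul_pow] at hn
  calc x ^ n = s ^ n * w ^ n * x ^ n := by rw [pow_mul_pow_eq_one n hs, one_mul]
    _ = 0 := by rw [mul_assoc, hn, mul_zero]

theorem exists_leftInverse_of_mem_jacobson {R : Type*} [Ring R] {x : R}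
    (hx : x ∈ Ring.jacobson R) : ∃ s, s * (1 + x) = 1 := by
  rw [← Ideal.jacobson_bot] at hx
  obtain ⟨s, hs⟩ := Ideal.exists_mul_add_sub_mem_of_mem_jacobson x hx
  exact ⟨s, by rw [add_comm]; exact sub_eq_zero.1 hs⟩

theorem IsYaqubNilClean.isNilpotent_of_mem_jacobson {R : Type*} [Ring R] (h : IsYaqubNilClean R)
    {x : R} (hx : x ∈ Ring.jacobson R) : IsNilpotent x := by
  have hx2 : x * x ∈ Ring.jacobson R := Ideal.mul_mem_left _ x hx
  rcases h x with h | h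
  · obtain ⟨s, hs⟩ := exists_leftInverse_of_mem_jacobson hx2
    refine isNilpotent_of_isNilpotent_mul_of_leftInverse (w := 1 + x * x) ?_ hs ?_
    · exact (Commute.one_right x).add_right ((Commute.refl x).mul_right (Commute.refl x))
    · convert! h using 1
      noncomm_ring
  · obtain ⟨s, hs⟩ := exists_leftInverse_of_mem_jacobson (neg_mem hx2)
    refine isNilpotent_of_isNilpotent_mul_of_leftInverse (w := 1 + -(x * x)) ?_ hs ?_
    · exact (Commute.one_right x).add_right
        ((Commute.refl x).mul_right (Commute.refl x)).neg_right
    · convert! h using 1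
      noncomm_ring

/-! ### Zero radical implies reduced -/

theorem mem_jacobson_of_forall_isNilpotent_mul {S : Type*} [Ring S] {x : S}
    (h : ∀ y, IsNilpotent (y * x)) : x ∈ Ring.jacobson S := by
  rw [← Ideal.jacobson_bot, Ideal.mem_jacobson_iff]
  intro y
  obtain ⟨z, hz⟩ := (h y).isUnit_one_add.exists_left_inv
  refine ⟨z, ?_⟩
  rw [Ideal.mem_bot, sub_eq_zero, ← hz]
  noncomm_ring

/-- If `a ^ n` is a multiple of `a ^ (n + 1)` by an element commuting with `a`, some nonzero
multiple of `a` is idempotent unless `a` is nilpotent. -/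
theorem exists_isIdempotentElem_mul_of_pow_eq {S : Type*} [Ring S] {a q : S} {n : ℕ}
    (hq : Commute a q) (hn : a ^ n = a ^ (n + 1) * q) (ha : ¬ IsNilpotent a) :
    ∃ t, IsIdempotentElem (t * a) ∧ t * a ≠ 0 := by
  have hstep : ∀ k, a ^ n = a ^ (n + k) * q ^ k := by
    intro k
    induction k with
    | zero => simp
    | succ k ih =>
      calc a ^ n = a ^ (k + n) * q ^ k := by rw [add_comm k, ← ih]
        _ = a ^ k * (a ^ (n + 1) * q) * q ^ k := by rw [pow_add, ← hn]
        _ = a ^ k * a ^ (n + 1) * (q * q ^ k) := by simp only [mul_assoc]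
        _ = a ^ (n + (k + 1)) * q ^ (k + 1) := by
          rw [← pow_add, ← pow_succ']; congr 2; ring
  have h1 := hstep (n + 1)
  have hcomm : Commute (q ^ (n + 1)) (a ^ (n + 1)) := (hq.pow_pow _ _).symm
  have h2 : a ^ (n + 1) = a ^ (n + 1) * a ^ (n + 1) * q ^ (n + 1) := by
    calc a ^ (n + 1) = a * a ^ n := pow_succ' a n
      _ = a * (a ^ (n + (n + 1)) * q ^ (n + 1)) := by rw [← h1]
      _ = a ^ (n + 1) * a ^ (n + 1) * q ^ (n + 1) := by
        rw [← mul_assoc, ← pow_succ', ← pow_add]; congr 2; ring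
  -- The idempotent is `e = q ^ (n + 1) * a ^ (n + 1)`; by `h2` it fixes `a ^ (n + 1)`, so `e = 0`
  -- would make `a` nilpotent.
  refine ⟨q ^ (n + 1) * a ^ n, ?_, ?_⟩
  · rw [mul_assoc, ← pow_succ]
    change q ^ (n + 1) * a ^ (n + 1) * (q ^ (n + 1) * a ^ (n + 1)) = q ^ (n + 1) * a ^ (n + 1)
    rw [mul_assoc, hcomm.eq, ← mul_assoc (a ^ (n + 1)), ← h2, hcomm.eq]
  · intro h0
    rw [mul_assoc, ← pow_succ] at h0
    refine ha ⟨n + 1, ?_⟩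
    rw [h2, mul_assoc, ← hcomm.eq, h0, mul_zero]

/-- Expanding `1 - (1 - ap)^n` as `ap` times a geometric sum turns `a^n (1 - ap)^n = 0` into `a^n =
a^(n+1) q`. -/
theorem exists_isIdempotentElem_mul_of_isNilpotent {S : Type*} [Ring S] {a p : S}
    (hp : Commute a p) (h : IsNilpotent (a * (1 - a * p))) (ha : ¬ IsNilpotent a) :
    ∃ t, IsIdempotentElem (t * a) ∧ t * a ≠ 0 := by
  obtain ⟨n, hn⟩ := h
  have hap : Commute a (a * p) := (Commute.refl a).mul_right hp
  have h1 : Commute a (1 - a * p) := (Commute.one_right a).sub_right hap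
  rw [h1.mul_pow] at hn
  have hs : Commute a (∑ i ∈ Finset.range n, (1 - a * p) ^ i) :=
    Commute.sum_right _ _ _ fun i _ => h1.pow_right i
  refine exists_isIdempotentElem_mul_of_pow_eq (n := n) (hp.mul_right hs) ?_ ha
  have hg := mul_neg_geom_sum (1 - a * p) n
  rw [sub_sub_cancel] at hg
  rw [pow_succ, mul_assoc, ← mul_assoc a p, hg, mul_sub, hn, mul_one, sub_zero]

theorem IsYaqubNilClean.exists_isIdempotentElem_mul {S : Type*} [Ring S] (h : IsYaqubNilClean S)
    {a : S} (ha : ¬ IsNilpotent a) : ∃ t, IsIdempotentElem (t * a) ∧ t * a ≠ 0 := by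
  rcases h a with h | h
  · refine exists_isIdempotentElem_mul_of_isNilpotent (p := -a) (Commute.refl a).neg_right ?_ ha
    convert! h using 1
    noncomm_ring
  · refine exists_isIdempotentElem_mul_of_isNilpotent (p := a) (Commute.refl a) ?_ ha
    convert! h using 1
    noncomm_ring

/-- A Yaqub nil-clean ring contains no nonzero system of `2 × 2` matrix units. -/
theorem IsYaqubNilClean.eq_zero_of_matrixUnits {S : Type*} [Ring S] (h : IsYaqubNilClean S)
    {e u w : S} (hee : e * e = e) (hue : u * e = u) (heu : e * u = 0) (hew : e * w = w)
    (hwe : w * e = 0) (hwu : w * u = e) : e = 0 := by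
  have huu : u * u = 0 := by rw [← hue, mul_assoc, ← mul_assoc e, heu, zero_mul, mul_zero]
  have hww : w * w = 0 := by rw [← hew, mul_assoc, ← mul_assoc w, hwe, zero_mul, mul_zero]
  obtain ⟨f, hf⟩ : ∃ f, u * w = f := ⟨_, rfl⟩
  have hff : f * f = f := by
    rw [← hf, mul_assoc, ← mul_assoc w, hwu, hew]
  have hef : e * f = 0 := by rw [← hf, ← mul_assoc, heu, zero_mul]
  have hfe : f * e = 0 := by rw [← hf, mul_assoc, hwe, mul_zero]
  have hfu : f * u = u := by rw [← hf, mul_assoc, hwu, hue]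
  have huf : u * f = 0 := by rw [← hf, ← mul_assoc, huu, zero_mul]
  have hwf : w * f = w := by rw [← hf, ← mul_assoc, hwu, hew]
  have hfw : f * w = 0 := by rw [← hf, mul_assoc, hww, mul_zero]
  -- Test matrix `b = diag(1, 2)`: `b + b³` acts on `e` as `2`, and `b³ - b` acts on `f` as `6`.
  have six : ∃ n : ℕ, (6 : ℤ) ^ n • e = 0 := by
    have hb2 : (e + 2 • f) * (e + 2 • f) = e + 4 • f := by
      simp only [add_mul, mul_add, smul_mul_assoc, mul_smul_comm, hee, hff, hef, hfe]
      module
    have hb3 : (e + 2 • f) ^ 3 = e + 8 • f := by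
      rw [pow_succ, pow_two, hb2]
      simp only [add_mul, mul_add, smul_mul_assoc, mul_smul_comm, hee, hff, hef, hfe]
      module
    rcases h (e + 2 • f) with h | h
    · obtain ⟨n, hn⟩ := h.exists_pow_zsmul_eq_zero (e := e) (k := 2) (by
        rw [hb3]
        simp only [add_mul, smul_mul_assoc, hee, hfe]
        module)
      refine ⟨n, ?_⟩
      rw [show (6 : ℤ) = 3 * 2 by norm_num, mul_pow, mul_smul, hn, smul_zero]
    · obtain ⟨n, hn⟩ := h.neg.exists_pow_zsmul_eq_zero (e := f) (k := 6) (by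
        rw [hb3]
        simp only [add_mul, sub_mul, neg_mul, smul_mul_assoc, hff, hef]
        module)
      refine ⟨n, ?_⟩
      calc (6 : ℤ) ^ n • e = w * ((6 : ℤ) ^ n • f) * u := by
            rw [mul_smul_comm, smul_mul_assoc, hwf, hwu]
        _ = 0 := by rw [hn, mul_zero, zero_mul]
  -- Test matrix with `a² = a + 1` (Fibonacci): `a + a³ = 3a + 1` has determinant `-5` and `a - a³ =
  -- -(a + 1)` has determinant `1`. The multipliers below are adjugates up to sign.
  have five : ∃ n : ℕ, (5 : ℤ) ^ n • e = 0 := by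
    obtain ⟨a, ha⟩ : ∃ a, u + w + f = a := ⟨_, rfl⟩
    obtain ⟨g, hg⟩ : ∃ g, e + f = g := ⟨_, rfl⟩
    have hge : g * e = e := by rw [← hg, add_mul, hee, hfe, add_zero]
    have hgg : g * g = g := by simp [← hg, add_mul, mul_add, hee, hff, hef, hfe]
    have hag : a * g = a := by
      simp only [← hg, ← ha, add_mul, mul_add, hue, hwe, hfe, huf, hwf, hff]
      abel
    have hga : g * a = a := by
      simp only [← hg, ← ha, add_mul, mul_add, heu, hew, hef, hfu, hfw, hff]
      abel
    have haa : a * a = a + g := by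
      simp only [← hg, ← ha, add_mul, mul_add, huu, hf, huf, hwu, hww, hwf, hfu, hfw, hff]
      abel
    have haaa : a ^ 3 = 2 • a + g := by
      rw [pow_succ, pow_two, haa, add_mul, haa, hga]
      module
    have hc : Commute g a := by rw [commute_iff_eq, hag, hga]
    rcases h a with h | h
    · have hcomm : Commute (3 • a - 4 • g) (a + a ^ 3) := by
        refine Commute.sub_left ?_ ?_
        · exact ((Commute.refl a).add_right ((Commute.refl a).pow_right 3)).smul_left 3
        · exact (hc.add_right (hc.pow_right 3)).smul_left 4
      have hn := hcomm.isNilpotent_mul_left h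
      refine hn.exists_pow_zsmul_eq_zero ?_
      have : (3 • a - 4 • g) * (a + a ^ 3) = (5 : ℤ) • g := by
        rw [haaa]
        simp only [sub_mul, mul_add, smul_mul_assoc, mul_smul_comm, haa, hga, hag, hgg]
        module
      rw [this, smul_mul_assoc, hge]
    · have hcomm : Commute (a - 2 • g) (a - a ^ 3) := by
        refine Commute.sub_left ?_ ?_
        · exact (Commute.refl a).sub_right ((Commute.refl a).pow_right 3)
        · exact (hc.sub_right (hc.pow_right 3)).smul_left 2
      have hn := hcomm.isNilpotent_mul_left h
      obtain ⟨n, hn⟩ := hn.exists_pow_zsmul_eq_zero (e := e) (k := 1) (by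
        have : (a - 2 • g) * (a - a ^ 3) = g := by
          rw [haaa]
          simp only [sub_mul, mul_add, mul_sub, smul_mul_assoc, mul_smul_comm, haa, hga, hag, hgg]
          module
        rw [this, hge, one_smul])
      rw [one_pow, one_smul] at hn
      exact ⟨0, by rw [hn, smul_zero]⟩
  obtain ⟨m, hm⟩ := six
  obtain ⟨n, hn⟩ := five
  obtain ⟨r, s, hrs⟩ : IsCoprime ((6 : ℤ) ^ m) (5 ^ n) :=
    IsCoprime.pow (Int.isCoprime_iff_gcd_eq_one.2 (by norm_num))
  rw [← one_zsmul e, ← hrs, add_smul, mul_smul, mul_smul, hm, hn, smul_zero, smul_zero, add_zero]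

theorem IsYaqubNilClean.isReduced_of_jacobson_eq_bot {S : Type*} [Ring S] (h : IsYaqubNilClean S)
    (hJ : Ring.jacobson S = ⊥) : IsReduced S := by
  have key : ∀ x : S, x * x = 0 → x = 0 := by
    intro x hx
    by_contra hne
    obtain ⟨y, hy⟩ : ∃ y, ¬ IsNilpotent (y * x) := by
      by_contra! hall
      have := mem_jacobson_of_forall_isNilpotent_mul hall
      rw [hJ, Ideal.mem_bot] at this
      exact hne this
    obtain ⟨t, hid, hne0⟩ := h.exists_isIdempotentElem_mul hy
    rw [← mul_assoc] at hid hne0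
    obtain ⟨e, he⟩ : ∃ e, t * y * x = e := ⟨_, rfl⟩
    rw [he] at hid hne0
    have hee : e * e = e := hid
    have hex : e * x = 0 := by rw [← he, mul_assoc, hx, mul_zero]
    have hezx : e * (t * y) * (x * e) = e := by
      rw [mul_assoc, ← mul_assoc (t * y), he, hee, hee]
    -- Since `ex = 0`, the factor `1 - e` in `w` forces `we = 0` without changing the product `wu =
    -- e`.
    refine hne0 (h.eq_zero_of_matrixUnits (e := e) (u := x * e)
      (w := e * (t * y) * (1 - e)) hee ?_ ?_ ?_ ?_ ?_)
    · rw [mul_assoc, hee]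
    · rw [← mul_assoc, hex, zero_mul]
    · rw [← mul_assoc, ← mul_assoc, hee]
    · rw [mul_assoc, sub_mul, one_mul, hee, sub_self, mul_zero]
    · rw [mul_assoc, sub_mul, one_mul, ← mul_assoc e x, hex, zero_mul, sub_zero, hezx]
  exact isReduced_iff_pow_one_lt 2 one_lt_two |>.2 fun x hx => key x (by rw [← pow_two, hx])

/-! ### Reduced rings: components and commutativity -/

theorem IsIdempotentElem.commute_of_isReduced {S : Type*} [Ring S] [IsReduced S] {e : S}
    (he : IsIdempotentElem e) (x : S) : Commute e x := by
  have hee : e * e = e := he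
  have h1 : e * x * (1 - e) = 0 := by
    refine IsReduced.eq_zero _ ⟨2, ?_⟩
    rw [pow_two]
    calc e * x * (1 - e) * (e * x * (1 - e)) = e * x * (e - e * e) * x * (1 - e) := by noncomm_ring
      _ = 0 := by rw [hee]; simp
  have h2 : (1 - e) * x * e = 0 := by
    refine IsReduced.eq_zero _ ⟨2, ?_⟩
    rw [pow_two]
    calc (1 - e) * x * e * ((1 - e) * x * e) = (1 - e) * x * (e - e * e) * x * e := by noncomm_ring
      _ = 0 := by rw [hee]; simp
  have h3 : e * x - x * e = e * x * (1 - e) - (1 - e) * x * e := by noncomm_ring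
  rw [h1, h2, sub_zero, sub_eq_zero] at h3
  exact h3

theorem IsReduced.eq_zero_of_mul_self {S : Type*} [Ring S] [IsReduced S] {x : S}
    (h : x * x = 0) : x = 0 :=
  IsReduced.eq_zero x ⟨2, by rw [pow_two, h]⟩

theorem IsYaqubNilClean.add_eq_zero_or_sub_eq_zero {S : Type*} [Ring S] [IsReduced S]
    (h : IsYaqubNilClean S) (a : S) : a + a ^ 3 = 0 ∨ a - a ^ 3 = 0 :=
  (h a).imp (IsReduced.eq_zero _) (IsReduced.eq_zero _)

theorem isIdempotentElem_mul_self_of_pow_three {S : Type*} [Ring S] {x : S} (h : x ^ 3 = x) :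
    IsIdempotentElem (x * x) := by
  rw [IsIdempotentElem, show x * x * (x * x) = x ^ 3 * x by noncomm_ring, h]

section ReducedYaqub

variable {S : Type*} [Ring S] [IsReduced S]

theorem isIdempotentElem_of_add_self_eq_zero {y : S} (h : y + y ^ 3 = 0 ∨ y - y ^ 3 = 0)
    (h2 : y + y = 0) : IsIdempotentElem y := by
  have hneg : y = -y := eq_neg_of_add_eq_zero_left h2
  have h3 : y * y * y = y := by
    rcases h with h | h
    · rw [← pow_two, ← pow_succ, eq_neg_of_add_eq_zero_right h, ← hneg]
    · rw [← pow_two, ← pow_succ, ← sub_eq_zero.1 h]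
  have hsq : (y + y * y) * (y + y * y) = 0 := by
    calc (y + y * y) * (y + y * y) = y * y + (y * y * y + y * y * y) + y * (y * y * y) := by
          noncomm_ring
      _ = y * (y + y) + (y + y) := by rw [h3]; noncomm_ring
      _ = 0 := by rw [h2, mul_zero, add_zero]
  have := IsReduced.eq_zero_of_mul_self hsq
  rw [IsIdempotentElem, eq_neg_of_add_eq_zero_right this, ← hneg]

theorem IsYaqubNilClean.six_eq_zero_or_ten_eq_zero (h : IsYaqubNilClean S) :
    (6 : S) = 0 ∨ (10 : S) = 0 := by
  rcases h.add_eq_zero_or_sub_eq_zero 2 with h | h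
  · right
    rw [← h]
    norm_num
  · left
    rw [← neg_eq_zero, ← h]
    norm_num

/-- As `30 = 0`, the central idempotent `15` projects onto the 2-component. -/
theorem IsYaqubNilClean.isIdempotentElem_fifteen_mul (h : IsYaqubNilClean S) (x : S) :
    IsIdempotentElem (15 * x) := by
  refine isIdempotentElem_of_add_self_eq_zero (h.add_eq_zero_or_sub_eq_zero _) ?_
  have h30 : (30 : S) = 0 := by
    rcases h.six_eq_zero_or_ten_eq_zero with h | h
    · rw [show (30 : S) = 6 * 5 by norm_num, h, zero_mul]
    · rw [show (30 : S) = 10 * 3 by norm_num, h, zero_mul]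
  rw [← add_mul, show (15 + 15 : S) = 30 by norm_num, h30, zero_mul]

theorem IsYaqubNilClean.pow_three_eq_self_of_three_mul_eq_zero (h : IsYaqubNilClean S) {y : S}
    (hy : 3 * y = 0) : y ^ 3 = y := by
  rcases h.add_eq_zero_or_sub_eq_zero y with h1 | h1
  · have hy' : y + y + y = 0 := by rw [← hy]; noncomm_ring
    have h3 : y * y * y = -y := by
      rw [← pow_two, ← pow_succ]; exact eq_neg_of_add_eq_zero_right h1
    obtain ⟨v, hv⟩ : ∃ v, y * y = v := ⟨_, rfl⟩
    have hv2 : v * v = -v := by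
      rw [← hv]
      calc y * y * (y * y) = y * (y * y * y) := by noncomm_ring
        _ = -(y * y) := by rw [h3, mul_neg]
    have hv3 : v + v + v = 0 := by
      rw [← hv, ← mul_add, ← mul_add, hy', mul_zero]
    have hyv : y * v = -y := by rw [← hv, ← mul_assoc, h3]
    have hvy : v * y = -y := by rw [← hv, h3]
    -- Model: `y = i` in the field of nine elements, where `v = -1` and `z = 1 + i` has order 8, so
    -- `z³ ≠ ±z`.
    obtain ⟨z, hz⟩ : ∃ z, y - v = z := ⟨_, rfl⟩
    have hz2 : z * z = y + y := by
      rw [← hz]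
      calc (y - v) * (y - v) = y * y - y * v - v * y + v * v := by noncomm_ring
        _ = y + y := by rw [hv, hyv, hvy, hv2]; abel
    have hz3 : z ^ 3 = v + v + y + y := by
      rw [pow_succ, pow_two, hz2, ← hz]
      calc (y + y) * (y - v) = y * y + y * y - y * v - y * v := by noncomm_ring
        _ = v + v + y + y := by rw [hv, hyv]; abel
    suffices y = 0 by rw [this, zero_pow three_ne_zero]
    rcases h.add_eq_zero_or_sub_eq_zero z with h2 | h2
    · have hv0 : v = 0 := by
        calc v = z + z ^ 3 - (y + y + y) := by rw [hz3, ← hz]; abel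
          _ = 0 := by rw [h2, hy', sub_zero]
      rw [← neg_eq_zero, ← hyv, hv0, mul_zero]
    · calc y = -(z - z ^ 3) - (v + v + v) := by rw [hz3, ← hz]; abel
        _ = 0 := by rw [h2, hv3, neg_zero, sub_zero]
  · exact (sub_eq_zero.1 h1).symm

theorem IsYaqubNilClean.pow_five (h : IsYaqubNilClean S) (y : S) : y ^ 5 = y := by
  rcases h.add_eq_zero_or_sub_eq_zero y with h1 | h1
  · have h3 : y ^ 3 = -y := eq_neg_of_add_eq_zero_right h1
    rw [show y ^ 5 = y ^ 3 * y * y by noncomm_ring, h3,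
      show -y * y * y = -y ^ 3 by noncomm_ring, h3, neg_neg]
  · have h3 : y ^ 3 = y := (sub_eq_zero.1 h1).symm
    rw [show y ^ 5 = y ^ 3 * y * y by noncomm_ring, h3,
      show y * y * y = y ^ 3 by noncomm_ring, h3]

/-- Here `6` projects onto the 5-component. There `2 - 6v`, with `v = y⁴` idempotent, is `2` where
`v = 0` and `1` where `v = 1`; modulo 5 these need opposite signs in `a³ = ±a`, so only one value
occurs. -/
theorem IsYaqubNilClean.six_mul_pow_four (h : IsYaqubNilClean S) (h10 : (10 : S) = 0) (y : S) :
    6 * y ^ 4 = 0 ∨ 6 * y ^ 4 = 6 := by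
  obtain ⟨v, hv⟩ : ∃ v, y ^ 4 = v := ⟨_, rfl⟩
  have hvv : v * v = v := by
    rw [← hv, show y ^ 4 * y ^ 4 = y ^ 5 * y ^ 3 by simp only [← pow_add], h.pow_five, ← pow_succ']
  have ha3 : (2 - 6 * v) ^ 3 = 8 - 72 * v + 216 * (v * v) - 216 * (v * v * v) := by
    noncomm_ring
    norm_num
    abel
  rw [hv]
  rcases h.add_eq_zero_or_sub_eq_zero (2 - 6 * v) with h1 | h1
  · left
    calc 6 * v = 3 * ((2 - 6 * v) + (2 - 6 * v) ^ 3) + 10 * (24 * v - 3) := by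
          rw [ha3, hvv, hvv]; noncomm_ring; norm_num [zsmul_eq_mul]
      _ = 0 := by rw [h1, h10, zero_mul, mul_zero, add_zero]
  · right
    calc 6 * v = ((2 - 6 * v) - (2 - 6 * v) ^ 3) + 10 * (-6 * v) + 6 := by
          rw [ha3, hvv, hvv]; noncomm_ring; norm_num [zsmul_eq_mul]
      _ = 6 := by rw [h1, h10, zero_mul, zero_add, zero_add]

/-- In characteristic dividing `10`, the component of characteristic `5` has at most the five
elements `0, ±1, ±2`. -/
theorem IsYaqubNilClean.exists_six_mul_eq_intCast (h : IsYaqubNilClean S) (h10 : (10 : S) = 0)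
    (x : S) : ∃ k : ℤ, 6 * x = 6 * (k : S) := by
  have hzero : ∀ z : S, 6 * z ^ 4 = 0 → 6 * z = 0 := by
    intro z hz
    rw [← h.pow_five z, pow_succ, ← mul_assoc, hz, zero_mul]
  have h30 : (30 : S) = 0 := by rw [show (30 : S) = 10 * 3 by norm_num, h10, zero_mul]
  rcases h.six_mul_pow_four h10 x with h4 | h4
  · exact ⟨0, by rw [hzero x h4]; simp⟩
  rcases h.add_eq_zero_or_sub_eq_zero x with h1 | h1
  · have h2 : 6 * (x * x) = -6 := by
      calc 6 * (x * x) = 6 * (x * (x + x ^ 3)) - 6 * x ^ 4 := by noncomm_ring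
        _ = -6 := by rw [h1, h4, mul_zero, mul_zero, zero_sub]
    -- In the 5-component `(x - 2)(x + 2) = x² - 4 = 0`, and `x - 2` is either zero or invertible.
    rcases h.six_mul_pow_four h10 (x - 2) with hz | hz
    · refine ⟨2, sub_eq_zero.1 ?_⟩
      rw [← hzero _ hz]
      push_cast
      noncomm_ring
    · refine ⟨-2, sub_eq_zero.1 ?_⟩
      calc 6 * x - 6 * ((-2 : ℤ) : S) = 6 * (x + 2) := by push_cast; noncomm_ring
        _ = 6 * (x - 2) ^ 4 * (x + 2) := by rw [hz]
        _ = (x - 2) ^ 3 * (6 * (x * x) - 24) := by noncomm_ring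
        _ = (x - 2) ^ 3 * (-30) := by rw [h2]; norm_num
        _ = 0 := by rw [h30, neg_zero, mul_zero]
  · have h2 : 6 * (x * x) = 6 := by
      calc 6 * (x * x) = 6 * (x * (x - x ^ 3)) + 6 * x ^ 4 := by noncomm_ring
        _ = 6 := by rw [h1, h4, mul_zero, mul_zero, zero_add]
    rcases h.six_mul_pow_four h10 (x - 1) with hz | hz
    · refine ⟨1, sub_eq_zero.1 ?_⟩
      rw [← hzero _ hz]
      push_cast
      noncomm_ring
    · refine ⟨-1, sub_eq_zero.1 ?_⟩
      calc 6 * x - 6 * ((-1 : ℤ) : S) = 6 * (x + 1) := by push_cast; noncomm_ring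
        _ = 6 * (x - 1) ^ 4 * (x + 1) := by rw [hz]
        _ = (x - 1) ^ 3 * (6 * (x * x) - 6) := by noncomm_ring
        _ = 0 := by rw [h2, sub_self, mul_zero]

theorem commute_of_pow_three_eq_self {x y : S} (hx : x ^ 3 = x) (hy : y ^ 3 = y)
    (hxy : (x * y) ^ 3 = x * y) (hyx : (y * x) ^ 3 = y * x) : Commute x y := by
  have h1 := (isIdempotentElem_mul_self_of_pow_three hx).commute_of_isReduced y
  have h2 := (isIdempotentElem_mul_self_of_pow_three hy).commute_of_isReduced x
  have h3 := (isIdempotentElem_mul_self_of_pow_three hyx).commute_of_isReduced x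
  calc x * y = x * (y * x * (y * x)) * y := by rw [← hxy]; noncomm_ring
    _ = y * x * (y * (x * x)) * y := by rw [← h3.eq]; noncomm_ring
    _ = y * (x ^ 3) * (y * y) := by rw [← h1.eq]; noncomm_ring
    _ = y * (x * (y * y)) := by rw [hx, mul_assoc]
    _ = y ^ 3 * x := by rw [← h2.eq]; noncomm_ring
    _ = y * x := by rw [hy]

theorem IsYaqubNilClean.commute (h : IsYaqubNilClean S) (x y : S) : Commute x y := by
  have h15 : ∀ x y : S, Commute (15 * x) y := fun x y =>
    (h.isIdempotentElem_fifteen_mul x).commute_of_isReduced y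
  rcases h.six_eq_zero_or_ten_eq_zero with h6 | h10
  · have hpow : ∀ z : S, (4 * z) ^ 3 = 4 * z := fun z =>
      h.pow_three_eq_self_of_three_mul_eq_zero (by
        rw [← mul_assoc, show (3 * 4 : S) = 6 * 2 by norm_num, h6, zero_mul, zero_mul])
    have h4 : Commute (4 * x) (4 * y) := by
      refine commute_of_pow_three_eq_self (hpow x) (hpow y) ?_ ?_
      · rw [mul_assoc, hpow]
      · rw [mul_assoc, hpow]
    -- When `6 = 0`, `4` projects onto the 3-component.
    have hdec : ∀ z : S, z = 4 * (4 * z) - 15 * z := fun z => by noncomm_ring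
    have hy : Commute (4 * x) y := by
      rw [hdec y]
      exact ((Commute.ofNat_right _ 4).mul_right h4).sub_right (h15 y _).symm
    rw [hdec x]
    exact ((Commute.ofNat_left 4 _).mul_left hy).sub_left (h15 x y)
  · obtain ⟨k, hk⟩ := h.exists_six_mul_eq_intCast h10 x
    have hx : x = 6 * (6 * (k : S)) - 15 * x := by
      calc x = 6 * (6 * x) - 15 * x - 10 * (2 * x) := by noncomm_ring
        _ = 6 * (6 * (k : S)) - 15 * x := by rw [hk, h10, zero_mul, sub_zero]
    rw [hx]
    exact ((Commute.ofNat_left 6 _).mul_left ((Commute.ofNat_left 6 _).mul_left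
      (Int.cast_commute k y))).sub_left (h15 x y)

end ReducedYaqub

/-! ### Splitting the commutative quotient -/

theorem exists_ringHom_zmod_three_ne_zero {S : Type*} [CommRing S] (h3 : (3 : S) = 0)
    (h : ∀ x : S, x ^ 3 = x) {x : S} (hx : x ≠ 0) : ∃ f : S →+* ZMod 3, f x ≠ 0 := by
  have hnil : x ∉ nilradical S := by
    rintro ⟨n, hn⟩
    have key : ∀ m : ℕ, x ^ 3 ^ m = x := by
      intro m
      induction m with
      | zero => simp
      | succ m ih => rw [pow_succ, pow_mul, ih, h]
    apply hx
    rw [← key n]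
    exact pow_eq_zero_of_le (Nat.lt_pow_self (by norm_num)).le hn
  rw [nilradical_eq_sInf, Ideal.mem_sInf] at hnil
  push Not at hnil
  -- The domain `S ⧸ P` consists of roots of `t(t - 1)(t + 1)`, hence is `ZMod 3`.
  obtain ⟨P, hP, hxP⟩ := hnil
  have : P.IsPrime := hP
  have : CharP (S ⧸ P) 3 := by
    refine (CharP.charP_iff_prime_eq_zero Nat.prime_three).2 ?_
    rw [← map_natCast (Ideal.Quotient.mk P), Nat.cast_ofNat, h3, map_zero]
  let g := ZMod.castHom (dvd_refl 3) (S ⧸ P)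
  have hg : Function.Bijective g := by
    refine ⟨ZMod.castHom_injective _, fun z => ?_⟩
    obtain ⟨s, rfl⟩ := Ideal.Quotient.mk_surjective z
    have hs : Ideal.Quotient.mk P s * ((Ideal.Quotient.mk P s - 1) * (Ideal.Quotient.mk P s + 1))
        = 0 := by
      rw [← sub_eq_zero.2 (congrArg (Ideal.Quotient.mk P) (h s)), map_pow]
      ring
    rcases mul_eq_zero.1 hs with hs | hs
    · exact ⟨0, by rw [hs, map_zero]⟩
    rcases mul_eq_zero.1 hs with hs | hs
    · exact ⟨1, by rw [sub_eq_zero.1 hs, map_one]⟩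
    · exact ⟨-1, by rw [eq_neg_of_add_eq_zero_left hs, map_neg, map_one]⟩
  refine ⟨((RingEquiv.ofBijective g hg).symm : (S ⧸ P) →+* ZMod 3).comp (Ideal.Quotient.mk P), ?_⟩
  intro h0
  apply hxP
  rw [← Ideal.Quotient.eq_zero_iff_mem]
  simpa using h0

theorem isYaqubRing_of_pow_three_eq_self {S : Type u} [CommRing S] (h3 : (3 : S) = 0)
    (h : ∀ x : S, x ^ 3 = x) : IsYaqubRing S := by
  refine ⟨S →+* ZMod 3, RingHom.pi fun f => f, ?_, fun f => ZMod.ringHom_surjective f⟩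
  refine (injective_iff_map_eq_zero _).2 fun x hx => ?_
  by_contra hne
  obtain ⟨f, hf⟩ := exists_ringHom_zmod_three_ne_zero h3 h hne
  exact hf (congrFun hx f)

theorem nonempty_ringEquiv_quotient_prod {S : Type*} [CommRing S] {m n : ℕ} (hmn : m.Coprime n)
    (h : ((m * n : ℕ) : S) = 0) :
    Nonempty (S ≃+* (S ⧸ Ideal.span {(m : S)}) × (S ⧸ Ideal.span {(n : S)})) := by
  have hcop : IsCoprime (Ideal.span {(m : S)}) (Ideal.span {(n : S)}) :=
    (Ideal.isCoprime_span_singleton_iff _ _).2 hmn.cast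
  have hbot : Ideal.span {(m : S)} * Ideal.span {(n : S)} = ⊥ := by
    rw [Ideal.span_singleton_mul_span_singleton, ← Nat.cast_mul, h]
    exact Ideal.span_singleton_eq_bot.2 rfl
  exact ⟨((RingEquiv.quotientBot S).symm.trans (Ideal.quotEquivOfEq hbot.symm)).trans
    (Ideal.quotientMulEquivQuotientProd _ _ hcop)⟩

theorem natCast_quotient_span_singleton_eq_zero {S : Type*} [CommRing S] (n : ℕ) :
    (n : S ⧸ Ideal.span {(n : S)}) = 0 := by
  rw [← map_natCast (Ideal.Quotient.mk _), Ideal.Quotient.eq_zero_iff_mem]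
  exact Ideal.mem_span_singleton_self _

theorem IsYaqubNilClean.nonempty_ringEquiv_of_commRing {S : Type u} [CommRing S] [IsReduced S]
    (h : IsYaqubNilClean S) :
    (∃ (R₁ : Type u) (_ : BooleanRing R₁) (R₂ : Type u) (_ : Ring R₂), IsYaqubRing R₂ ∧
        Nonempty (S ≃+* R₁ × R₂)) ∨
      (∃ (R₁ : Type u) (_ : BooleanRing R₁), Nonempty (S ≃+* R₁ × ZMod 5)) := by
  let B : BooleanRing (S ⧸ Ideal.span {((2 : ℕ) : S)}) :=
    { (inferInstance : CommRing (S ⧸ Ideal.span {((2 : ℕ) : S)})) with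
      isIdempotentElem := fun z => by
        obtain ⟨s, rfl⟩ := Ideal.Quotient.mk_surjective z
        have h2 := natCast_quotient_span_singleton_eq_zero (S := S) 2
        have hs := (h.isIdempotentElem_fifteen_mul s).map
          (Ideal.Quotient.mk (Ideal.span {((2 : ℕ) : S)}))
        rw [map_mul, map_ofNat, show (15 : S ⧸ Ideal.span {((2 : ℕ) : S)}) = (2 : ℕ) * 7 + 1 by
          norm_num, h2, zero_mul, zero_add, one_mul] at hs
        exact hs }
  by_cases h6 : (6 : S) = 0
  · left
    refine ⟨_, B, S ⧸ Ideal.span {((3 : ℕ) : S)}, inferInstance, ?_,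
      nonempty_ringEquiv_quotient_prod (by norm_num) (by simpa using h6)⟩
    have h3 := natCast_quotient_span_singleton_eq_zero (S := S) 3
    refine isYaqubRing_of_pow_three_eq_self (by simpa using h3) fun z => ?_
    obtain ⟨s, rfl⟩ := Ideal.Quotient.mk_surjective z
    have hs := congrArg (Ideal.Quotient.mk (Ideal.span {((3 : ℕ) : S)}))
      (h.pow_three_eq_self_of_three_mul_eq_zero (y := 4 * s) (by linear_combination 2 * s * h6))
    rw [map_pow, map_mul, map_ofNat, show (4 : S ⧸ Ideal.span {((3 : ℕ) : S)}) = (3 : ℕ) + 1 by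
      norm_num, h3, zero_add, one_mul] at hs
    exact hs
  · right
    have h10 : (10 : S) = 0 := h.six_eq_zero_or_ten_eq_zero.resolve_left h6
    have h5 := natCast_quotient_span_singleton_eq_zero (S := S) 5
    -- If `5` were a unit, `10 = 0` would give `2 = 0`, against `6 ≠ 0`.
    have hnt : Nontrivial (S ⧸ Ideal.span {((5 : ℕ) : S)}) := by
      refine Ideal.Quotient.nontrivial_iff.2 fun htop => h6 ?_
      obtain ⟨c, hc⟩ := Ideal.mem_span_singleton'.1 ((Ideal.eq_top_iff_one _).1 htop)
      push_cast at hc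
      linear_combination 3 * c * h10 - 6 * hc
    have : CharP (S ⧸ Ideal.span {((5 : ℕ) : S)}) 5 :=
      (CharP.charP_iff_prime_eq_zero Nat.prime_five).2 h5
    let g := ZMod.castHom (dvd_refl 5) (S ⧸ Ideal.span {((5 : ℕ) : S)})
    have hg : Function.Bijective g := by
      refine ⟨ZMod.castHom_injective _, fun z => ?_⟩
      obtain ⟨s, rfl⟩ := Ideal.Quotient.mk_surjective z
      obtain ⟨k, hk⟩ := h.exists_six_mul_eq_intCast h10 s
      refine ⟨k, ?_⟩
      have hs := congrArg (Ideal.Quotient.mk (Ideal.span {((5 : ℕ) : S)})) hk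
      rw [map_mul, map_mul, map_ofNat,
        show (6 : S ⧸ Ideal.span {((5 : ℕ) : S)}) = (5 : ℕ) + 1 by norm_num, h5, zero_add,
        one_mul, one_mul, map_intCast] at hs
      rw [hs, map_intCast]
    obtain ⟨φ⟩ := nonempty_ringEquiv_quotient_prod (S := S) (m := 2) (n := 5) (by norm_num)
      (by simpa using h10)
    exact ⟨_, B, ⟨φ.trans (RingEquiv.prodCongr (RingEquiv.refl _)
      (RingEquiv.ofBijective g hg).symm)⟩⟩

theorem IsYaqubNilClean.nonempty_ringEquiv {S : Type u} [Ring S] [IsReduced S]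
    (h : IsYaqubNilClean S) :
    (∃ (R₁ : Type u) (_ : BooleanRing R₁) (R₂ : Type u) (_ : Ring R₂), IsYaqubRing R₂ ∧
        Nonempty (S ≃+* R₁ × R₂)) ∨
      (∃ (R₁ : Type u) (_ : BooleanRing R₁), Nonempty (S ≃+* R₁ × ZMod 5)) :=
  letI : CommRing S := { ‹Ring S› with mul_comm := fun x y => (h.commute x y).eq }
  h.nonempty_ringEquiv_of_commRing

theorem IsYaqubNilClean.of_surjective {R S : Type*} [Ring R] [Ring S] (h : IsYaqubNilClean R)
    (f : R →+* S) (hf : Function.Surjective f) : IsYaqubNilClean S := by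
  intro a
  obtain ⟨r, rfl⟩ := hf a
  refine (h r).imp (fun hr => ?_) (fun hr => ?_)
  · simpa using hr.map f
  · simpa using hr.map f

/-! ### The converse -/

theorem sub_pow_three_eq_zero_of_booleanRing {B : Type*} [BooleanRing B] (a : B) :
    a - a ^ 3 = 0 := by
  rw [pow_succ, pow_two, BooleanRing.mul_self, BooleanRing.mul_self, sub_self]

theorem add_pow_three_eq_zero_of_booleanRing {B : Type*} [BooleanRing B] (a : B) :
    a + a ^ 3 = 0 := by
  rw [pow_succ, pow_two, BooleanRing.mul_self, BooleanRing.mul_self, BooleanRing.add_self]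

theorem IsYaqubRing.sub_pow_three_eq_zero {S : Type u} [Ring S] (h : IsYaqubRing S) (a : S) :
    a - a ^ 3 = 0 := by
  obtain ⟨ι, f, hf, -⟩ := h
  refine hf ?_
  rw [map_sub, map_pow, map_zero]
  funext i
  have : ∀ z : ZMod 3, z - z ^ 3 = 0 := by decide
  exact this (f a i)

theorem zmod_five_add_or_sub_pow_three_eq_zero (a : ZMod 5) : a + a ^ 3 = 0 ∨ a - a ^ 3 = 0 := by
  decide +revert

theorem add_or_sub_pow_three_eq_zero_of_ringEquiv {S T : Type*} [Ring S] [Ring T] (φ : S ≃+* T)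
    (h : ∀ a : T, a + a ^ 3 = 0 ∨ a - a ^ 3 = 0) (a : S) : a + a ^ 3 = 0 ∨ a - a ^ 3 = 0 := by
  refine (h (φ a)).imp (fun h => φ.injective ?_) (fun h => φ.injective ?_)
  · simpa using h
  · simpa using h

theorem isYaqubNilClean_of_quotient {R : Type*} [Ring R]
    (hJ : ∀ x ∈ Ring.jacobson R, IsNilpotent x)
    (h : ∀ a : R ⧸ Ring.jacobson R, a + a ^ 3 = 0 ∨ a - a ^ 3 = 0) : IsYaqubNilClean R := by
  intro a
  refine (h (Ideal.Quotient.mk _ a)).imp (fun h => hJ _ ?_) (fun h => hJ _ ?_)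
  · rw [← Ideal.Quotient.eq_zero_iff_mem]
    simpa using h
  · rw [← Ideal.Quotient.eq_zero_iff_mem]
    simpa using h

theorem theorem3p6 (R : Type u) [Ring R] :
    IsYaqubNilClean R ↔
      (∀ x ∈ Ring.jacobson R, IsNilpotent x) ∧
      ((∃ (R₁ : Type u) (_ : BooleanRing R₁),
          Nonempty ((R ⧸ Ring.jacobson R) ≃+* R₁)) ∨
       (∃ (R₂ : Type u) (_ : Ring R₂), IsYaqubRing R₂ ∧
          Nonempty ((R ⧸ Ring.jacobson R) ≃+* R₂)) ∨
       Nonempty ((R ⧸ Ring.jacobson R) ≃+* ZMod 5) ∨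
       (∃ (R₁ : Type u) (_ : BooleanRing R₁) (R₂ : Type u) (_ : Ring R₂), IsYaqubRing R₂ ∧
          Nonempty ((R ⧸ Ring.jacobson R) ≃+* R₁ × R₂)) ∨
       (∃ (R₁ : Type u) (_ : BooleanRing R₁),
          Nonempty ((R ⧸ Ring.jacobson R) ≃+* R₁ × ZMod 5))) := by
  constructor
  · intro h
    refine ⟨fun x hx => h.isNilpotent_of_mem_jacobson hx, ?_⟩
    have hS := h.of_surjective _ (Ideal.Quotient.mk_surjective (I := Ring.jacobson R))
    have := hS.isReduced_of_jacobson_eq_bot (Ring.jacobson_quotient_jacobson R)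
    -- The two product forms suffice, since a factor `R₁` or `R₂` may be the zero ring.
    rcases hS.nonempty_ringEquiv with h | h
    · exact .inr (.inr (.inr (.inl h)))
    · exact .inr (.inr (.inr (.inr h)))
  · rintro ⟨hJ, h⟩
    refine isYaqubNilClean_of_quotient hJ ?_
    rcases h with ⟨R₁, _, ⟨φ⟩⟩ | ⟨R₂, _, hY, ⟨φ⟩⟩ | ⟨⟨φ⟩⟩ | ⟨R₁, _, R₂, _, hY, ⟨φ⟩⟩ |
      ⟨R₁, _, ⟨φ⟩⟩ <;> refine add_or_sub_pow_three_eq_zero_of_ringEquiv φ ?_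
    · exact fun a => .inr (sub_pow_three_eq_zero_of_booleanRing a)
    · exact fun a => .inr (hY.sub_pow_three_eq_zero a)
    · exact zmod_five_add_or_sub_pow_three_eq_zero
    · exact fun a => .inr
        (Prod.ext (sub_pow_three_eq_zero_of_booleanRing a.1) (hY.sub_pow_three_eq_zero a.2))
    -- The Boolean coordinate satisfies both identities, so the `ZMod 5` coordinate alone picks the
    -- sign.
    · exact fun a => (zmod_five_add_or_sub_pow_three_eq_zero a.2).imp
        (Prod.ext (add_pow_three_eq_zero_of_booleanRing a.1))
        (Prod.ext (sub_pow_three_eq_zero_of_booleanRing a.1))
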